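/- Let $r\ge 3$ be an integer and $0\le\rho<1$. In game $A$ a fair coin is tossed. In game $B$ a coin is tossed whose probability of heads is $p_0=\rho^{r-1}/(1+\rho^{r-1})$ if the player's current (integer) capital is a multiple of $r$, and $p_1=1/(1+\rho)$ otherwise; for $\rho=0$ this means $p_0=0$ and $p_1=1$. In either game the player wins one unit with heads and loses one unit with tails. For $0<\gamma<1$, in the random mixture $\gamma A+(1-\gamma)B$, at each turn, independently of the past, game $A$ is played with probability $\gamma$ and game $B$ is played otherwise. Its rate of profit $\mu(r,\rho,\gamma A+(1-\gamma)B)$ is the almost sure limit, as $n\to\infty$, of the cumulative profit after $n$ turns divided by $n$. For each integer $r\ge 5$ put $\gamma_r:=2/\sqrt r$, so that $0<\gamma_r<1$. Then the rate of profit $\mu(r,0,\gamma_rA+(1-\gamma_r)B)$ exists and is the same for every initial capital $x\in\mathbb Z$, and $$1-\mu(r,0,\gamma_rA+(1-\gamma_r)B)\sim 2\gamma_r=\frac{4}{\sqrt r}\qquad\text{as } r\to\infty .$$ -/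

import Mathlib

open MeasureTheory ProbabilityTheory Filter Asymptotics
open scoped Topology NNReal ENNReal unitInterval

namespace Parrondo

noncomputable section

/-- Law of the capital after one turn that starts from capital `x` and is decided by a `p`-coin:
heads (probability `p`) wins one unit, tails (probability `1 - p`) loses one unit. -/
def coinStep (p : I) (x : ℤ) : Measure ℤ :=
  ENNReal.ofReal (p : ℝ) • Measure.dirac (x + 1)
    + ENNReal.ofReal (1 - (p : ℝ)) • Measure.dirac (x - 1)

instance (p : I) (x : ℤ) : IsProbabilityMeasure (coinStep p x) := by
  refine ⟨?_⟩
  simp only [coinStep, Measure.add_apply, Measure.smul_apply, measure_univ, smul_eq_mul, mul_one]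
  rw [← ENNReal.ofReal_add p.2.1 (sub_nonneg.2 p.2.2)]
  simp

/-- The fair coin. -/
def pA : I := ⟨1 / 2, by norm_num, by norm_num⟩

/-- The coin of game `B` when capital is a multiple of `r`: `p₀ = ρ ^ (r - 1) / (1 + ρ ^ (r - 1))`. -/
def p0 (r : ℕ) (ρ : ℝ≥0) : I :=
  ⟨(ρ : ℝ) ^ (r - 1) / (1 + (ρ : ℝ) ^ (r - 1)), by positivity,
    by rw [div_le_one (by positivity)]; linarith⟩

/-- The coin of game `B` when capital is not a multiple of `r`: `p₁ = 1 / (1 + ρ)`. -/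
def p1 (ρ : ℝ≥0) : I :=
  ⟨1 / (1 + (ρ : ℝ)), by positivity,
    by rw [div_le_one (by positivity)]; linarith [ρ.2]⟩

/-- One turn of game `A`. -/
def gameA (x : ℤ) : Measure ℤ := coinStep pA x

/-- One turn of game `B`. -/
def gameB (r : ℕ) (ρ : ℝ≥0) (x : ℤ) : Measure ℤ :=
  coinStep (if (r : ℤ) ∣ x then p0 r ρ else p1 ρ) x

instance (x : ℤ) : IsProbabilityMeasure (gameA x) := by
  unfold gameA; infer_instance

instance (r : ℕ) (ρ : ℝ≥0) (x : ℤ) : IsProbabilityMeasure (gameB r ρ x) := by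
  unfold gameB; infer_instance

/-- One turn of the random mixture `γ A + (1 - γ) B`, as a transition kernel for capital:
game `A` is played with probability `γ` and game `B` is played otherwise. -/
def mixture (r : ℕ) (ρ : ℝ≥0) (γ : I) : Kernel ℤ ℤ where
  toFun x := ENNReal.ofReal (γ : ℝ) • gameA x + ENNReal.ofReal (1 - (γ : ℝ)) • gameB r ρ x
  measurable' := measurable_of_countable _

instance (r : ℕ) (ρ : ℝ≥0) (γ : I) : IsMarkovKernel (mixture r ρ γ) := by
  refine ⟨fun x => ⟨?_⟩⟩
  change (ENNReal.ofReal (γ : ℝ) • gameA x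
    + ENNReal.ofReal (1 - (γ : ℝ)) • gameB r ρ x) Set.univ = 1
  simp only [Measure.add_apply, Measure.smul_apply, measure_univ, smul_eq_mul, mul_one]
  rw [← ENNReal.ofReal_add γ.2.1 (sub_nonneg.2 γ.2.2)]
  simp

/-- The transition from the capitals at times `0, …, n` to the capital at time `n + 1`; it depends
on the present capital only. -/
def transition (r : ℕ) (ρ : ℝ≥0) (γ : I) (n : ℕ) :
    Kernel ((_ : Finset.Iic n) → ℤ) ℤ :=
  (mixture r ρ γ).comap (fun h => h ⟨n, Finset.mem_Iic.2 le_rfl⟩) (measurable_pi_apply _)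

instance (r : ℕ) (ρ : ℝ≥0) (γ : I) (n : ℕ) : IsMarkovKernel (transition r ρ γ n) := by
  unfold transition; infer_instance

/-- The law, on the space of sequences `c 0, c 1, c 2, …` of capitals, of the Markov chain of
capitals when the mixture `γ A + (1 - γ) B` is played at every turn, starting from initial
capital `x`. -/
def capitalLaw (r : ℕ) (ρ : ℝ≥0) (γ : I) (x : ℤ) : Measure (ℕ → ℤ) :=
  Kernel.traj (X := fun _ => ℤ) (transition r ρ γ) 0 (fun _ => x)

instance (r : ℕ) (ρ : ℝ≥0) (γ : I) (x : ℤ) : IsProbabilityMeasure (capitalLaw r ρ γ x) := by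
  unfold capitalLaw; infer_instance

/-- `m` is the rate of profit `μ(r, ρ, γ A + (1 - γ) B)` from initial capital `x`: the cumulative
profit after `n` turns, divided by `n`, converges to `m` almost surely. -/
def IsRateOfProfit (r : ℕ) (ρ : ℝ≥0) (γ : I) (x : ℤ) (m : ℝ) : Prop :=
  ∀ᵐ c ∂(capitalLaw r ρ γ x),
    Tendsto (fun n : ℕ => ((c n - c 0 : ℤ) : ℝ) / (n : ℝ)) atTop (𝓝 m)

/-- There is at most one rate of profit. -/
theorem IsRateOfProfit.unique {r : ℕ} {ρ : ℝ≥0} {γ : I} {x : ℤ} {m m' : ℝ}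
    (h : IsRateOfProfit r ρ γ x m) (h' : IsRateOfProfit r ρ γ x m') : m = m' := by
  obtain ⟨c, hc, hc'⟩ := (h.and h').exists
  exact tendsto_nhds_unique hc hc'

/-- `γ_r = 2 / √r` as a probability. It is less than `1` exactly when `r ≥ 5`. -/
def gammaSeq (r : ℕ) (hr : 5 ≤ r) : I :=
  ⟨2 / √(r : ℝ), by positivity, by
    have h4 : (5 : ℝ) ≤ r := by exact_mod_cast hr
    have h2 : (2 : ℝ) ≤ √(r : ℝ) := Real.le_sqrt_of_sq_le (by linarith)
    exact (div_le_one (by linarith)).2 h2⟩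

end

end Parrondo

/-!
Let `P` be the transition operator of the chain `c` of capitals. If `f` is the identity plus a
bounded corrector and solves the Poisson equation `P f = f + m`, then `f (c n) - n m` is a
martingale with bounded increments. Its second moment grows linearly, so by Chebyshev's
inequality along the squares, and interpolation between them, `f (c n) / n` tends to `m` almost
surely, and so does `c n / n`.

Off the multiples of `r` the walk wins with a constant probability `p`, and `k ↦ s ^ k` is harmonic
there for `s = (1 - p) / p`. The defect of `1 - s ^ k` from its chord over a period is therefore a
periodic function with constant drift off the multiples of `r`, and a multiple of it corrects the
identity. The resulting rate is explicit. For `ρ = 0` and `q = γ / 2` the coins are `p₀ = q` and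
`p = 1 - q`, and one minus the rate is asymptotic to `2 q + 2 / (r q)`; the choice `q = 1 / √r`
balances the two terms.
-/

namespace Parrondo

noncomputable section

section BoundedDecrease

theorem tendsto_div_of_tendsto_sq_div_sq {u : ℕ → ℝ} {l D : ℝ} (hD : ∀ n, u n ≤ u (n + 1) + D)
    (hu : Tendsto (fun k : ℕ => u (k ^ 2) / (k : ℝ) ^ 2) atTop (𝓝 l)) :
    Tendsto (fun n : ℕ => u n / n) atTop (𝓝 l) := by
  have hdrift : ∀ v : ℕ → ℝ, (∀ᶠ n in atTop, v n ≠ 0) →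
      Tendsto (fun n => v n * D / v n) atTop (𝓝 D) := fun v hv =>
    tendsto_const_nhds.congr' (hv.mono fun n hn => (mul_div_cancel_left₀ D hn).symm)
  have hmono : Monotone fun n : ℕ => u n + n * D := monotone_nat_of_le_succ fun n => by
    push_cast
    linarith [hD n]
  have hratio : Tendsto (fun k : ℕ => (1 + 1 / ((k : ℝ) + 1)) ^ 2) atTop (𝓝 1) := by
    simpa using (tendsto_one_div_add_atTop_nhds_zero_nat (𝕜 := ℝ)).const_add 1 |>.pow 2
  have hlim : Tendsto (fun n : ℕ => (u n + n * D) / n) atTop (𝓝 (l + D)) := by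
    refine tendsto_div_of_monotone_of_exists_subseq_tendsto_div _ _ hmono fun a ha =>
      ⟨fun k => (k + 1) ^ 2, ?_, ?_, ?_⟩
    · filter_upwards [hratio.eventually_le_const ha] with k hk
      calc (((k + 1 + 1) ^ 2 : ℕ) : ℝ) = (1 + 1 / ((k : ℝ) + 1)) ^ 2 * ((k : ℝ) + 1) ^ 2 := by
            push_cast; field_simp
        _ ≤ a * (((k + 1) ^ 2 : ℕ) : ℝ) := by push_cast; gcongr
    · exact (tendsto_pow_atTop two_ne_zero).comp (tendsto_add_atTop_nat 1)
    · refine ((hu.add (hdrift (fun k => (k : ℝ) ^ 2) ?_)).comp (tendsto_add_atTop_nat 1)).congr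
        fun k => ?_
      · filter_upwards [eventually_ne_atTop 0] with k hk using by positivity
      · simp only [Function.comp_apply]
        push_cast
        ring
  have hdrift' := hdrift (fun n => (n : ℝ))
    (by filter_upwards [eventually_ne_atTop 0] with n hn using by positivity)
  simpa [← sub_div] using hlim.sub hdrift'

end BoundedDecrease

section SecondMoments

variable {Ω : Type*} [MeasurableSpace Ω] {P : Measure Ω} {S : ℕ → Ω → ℝ}

theorem integral_sub_sq_eq_variance_add_sq [IsProbabilityMeasure P] {X : Ω → ℝ}
    (hX : MemLp X 2 P) (a : ℝ) :
    ∫ ω, (X ω - a) ^ 2 ∂P = Var[X; P] + (P[X] - a) ^ 2 := by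
  have hvar : Var[fun ω => X ω - a; P] = ∫ ω, (X ω - a) ^ 2 ∂P - (∫ ω, (X ω - a) ∂P) ^ 2 :=
    variance_eq_sub (hX.sub (memLp_const a))
  rw [variance_sub_const hX.aestronglyMeasurable,
    integral_sub (hX.integrable one_le_two) (integrable_const a), integral_const,
    probReal_univ, one_smul] at hvar
  linarith

theorem lintegral_sub_sq_le_of_abs_sub_le [IsProbabilityMeasure P] {X : Ω → ℝ}
    (hX : Measurable X) {b B : ℝ} (hB : ∀ᵐ ω ∂P, |X ω - b| ≤ B) (a : ℝ) :
    ∫⁻ ω, ENNReal.ofReal ((X ω - a) ^ 2) ∂P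
      ≤ ENNReal.ofReal ((P[X] - a) ^ 2) + ENNReal.ofReal (B ^ 2) := by
  have hIcc : ∀ᵐ ω ∂P, X ω ∈ Set.Icc (b - B) (b + B) := hB.mono fun ω hω =>
    ⟨by linarith [(abs_le.1 hω).1], by linarith [(abs_le.1 hω).2]⟩
  have hL2 : MemLp X 2 P := memLp_of_bounded hIcc hX.aestronglyMeasurable 2
  have hvar : Var[X; P] ≤ B ^ 2 :=
    (variance_le_sq_of_bounded hIcc hX.aemeasurable).trans_eq (by ring)
  have hint : Integrable (fun ω => (X ω - a) ^ 2) P := (hL2.sub (memLp_const a)).integrable_sq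
  rw [← ofReal_integral_eq_lintegral_ofReal hint (ae_of_all _ fun ω => sq_nonneg _),
    integral_sub_sq_eq_variance_add_sq hL2,
    ← ENNReal.ofReal_add (sq_nonneg _) (sq_nonneg _)]
  exact ENNReal.ofReal_le_ofReal (by linarith)

theorem ae_tendsto_zero_of_tsum_lintegral_sq_ne_top (hS : ∀ n, Measurable (S n))
    (hsum : ∑' n, ∫⁻ ω, ENNReal.ofReal (S n ω ^ 2) ∂P ≠ ∞) :
    ∀ᵐ ω ∂P, Tendsto (fun n => S n ω) atTop (𝓝 0) := by
  have hmeas : ∀ n, Measurable fun ω => ENNReal.ofReal (S n ω ^ 2) :=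
    fun n => ((hS n).pow_const 2).ennreal_ofReal
  rw [← lintegral_tsum fun n => (hmeas n).aemeasurable] at hsum
  filter_upwards [ae_lt_top (Measurable.tsum hmeas) hsum] with ω hω
  have hsq : Tendsto (fun n => S n ω ^ 2) atTop (𝓝 0) :=
    ((ENNReal.summable_toReal hω.ne).congr fun n =>
      ENNReal.toReal_ofReal (sq_nonneg _)).tendsto_atTop_zero
  rw [tendsto_zero_iff_abs_tendsto_zero]
  simpa [Real.sqrt_sq_eq_abs, Function.comp_def] using hsq.sqrt

theorem ae_tendsto_div_zero_of_lintegral_sq_le (hS : ∀ n, Measurable (S n)) {V D : ℝ}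
    (hV : ∀ n : ℕ, ∫⁻ ω, ENNReal.ofReal (S n ω ^ 2) ∂P ≤ ENNReal.ofReal (n * V))
    (hD : ∀ᵐ ω ∂P, ∀ n, S n ω ≤ S (n + 1) ω + D) :
    ∀ᵐ ω ∂P, Tendsto (fun n : ℕ => S n ω / n) atTop (𝓝 0) := by
  have hmoment : ∀ k : ℕ, ∫⁻ ω, ENNReal.ofReal ((S (k ^ 2) ω / (k : ℝ) ^ 2) ^ 2) ∂P
      ≤ ENNReal.ofReal (V * (1 / (k : ℝ) ^ 2)) := fun k => calc
    _ = ENNReal.ofReal (1 / (k : ℝ) ^ 4) * ∫⁻ ω, ENNReal.ofReal (S (k ^ 2) ω ^ 2) ∂P := by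
        rw [← lintegral_const_mul _ ((hS _).pow_const 2).ennreal_ofReal]
        refine lintegral_congr fun ω => ?_
        rw [← ENNReal.ofReal_mul (by positivity)]
        ring_nf
    _ ≤ ENNReal.ofReal (1 / (k : ℝ) ^ 4) * ENNReal.ofReal ((k ^ 2 : ℕ) * V) := by
        gcongr
        exact hV _
    _ = _ := by
        rw [← ENNReal.ofReal_mul (by positivity)]
        push_cast
        rcases eq_or_ne (k : ℝ) 0 with hk | hk
        · simp [hk]
        · field_simp [hk]
  have hsummable : Summable fun k : ℕ => V * (1 / (k : ℝ) ^ 2) :=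
    (Real.summable_one_div_nat_pow.2 one_lt_two).mul_left _
  filter_upwards [hD, ae_tendsto_zero_of_tsum_lintegral_sq_ne_top
    (fun k => (hS (k ^ 2)).div_const _)
    (ne_top_of_le_ne_top hsummable.tsum_ofReal_ne_top (ENNReal.tsum_le_tsum hmoment))]
    with ω hω hsq using tendsto_div_of_tendsto_sq_div_sq hω hsq

end SecondMoments

theorem map_compProd_comap {α β γ : Type*} [MeasurableSpace α] [MeasurableSpace β]
    [MeasurableSpace γ] (μ : Measure α) [SFinite μ] (η : Kernel β γ) [IsSFiniteKernel η]
    {e : α → β} (he : Measurable e) :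
    (μ ⊗ₘ η.comap e he).map (Prod.map e id) = μ.map e ⊗ₘ η := by
  ext s hs
  have hmap : Measurable (Prod.map e id : α × γ → β × γ) := he.prodMap measurable_id
  rw [Measure.map_apply hmap hs, Measure.compProd_apply (hmap hs), Measure.compProd_apply hs,
    lintegral_map (Kernel.measurable_kernel_prodMk_left hs) he]
  rfl

section MarkovChain

variable {E : Type*} [MeasurableSpace E] (κ : Kernel E E) [IsMarkovKernel κ] (x : E)

/-- The law of the trajectory of the time-homogeneous Markov chain with transition kernel `κ`
started at `x`. -/
def chainLaw : Measure (ℕ → E) :=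
  Kernel.traj (X := fun _ => E)
    (fun n => κ.comap (fun h => h ⟨n, Finset.mem_Iic.2 le_rfl⟩) (measurable_pi_apply _))
    0 (fun _ => x)

instance : IsProbabilityMeasure (chainLaw κ x) := by
  unfold chainLaw; infer_instance

theorem chainLaw_map_zero : (chainLaw κ x).map (fun c => c 0) = Measure.dirac x := by
  have heval : Measurable fun h : Finset.Iic 0 → E => h ⟨0, Finset.mem_Iic.2 le_rfl⟩ :=
    measurable_pi_apply _
  have h := congrArg (Measure.map fun h : Finset.Iic 0 → E => h ⟨0, Finset.mem_Iic.2 le_rfl⟩)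
    (Kernel.traj_map_frestrictLe_apply (X := fun _ => E) (κ := fun n =>
      κ.comap (fun h => h ⟨n, Finset.mem_Iic.2 le_rfl⟩) (measurable_pi_apply _)) 0 0 fun _ => x)
  rw [Kernel.partialTraj_self, Kernel.id_apply, Measure.map_dirac' heval,
    Measure.map_map heval (by fun_prop)] at h
  exact h

theorem chainLaw_map_succ (n : ℕ) :
    (chainLaw κ x).map (fun c => (c n, c (n + 1))) = (chainLaw κ x).map (fun c => c n) ⊗ₘ κ := by
  have heval : Measurable fun h : Finset.Iic n → E => h ⟨n, Finset.mem_Iic.2 le_rfl⟩ :=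
    measurable_pi_apply _
  have h := congrArg
    (Measure.map (Prod.map (fun h : Finset.Iic n → E => h ⟨n, Finset.mem_Iic.2 le_rfl⟩) id))
    (Kernel.partialTraj_compProd_eq_map_traj (X := fun _ => E) (κ := fun n =>
      κ.comap (fun h => h ⟨n, Finset.mem_Iic.2 le_rfl⟩) (measurable_pi_apply _)) (Nat.zero_le n)
      (x₀ := fun _ => x))
  rw [map_compProd_comap, ← Kernel.traj_map_frestrictLe_apply, Measure.map_map heval (by fun_prop),
    Measure.map_map (heval.prodMap measurable_id) (by fun_prop)] at h
  exact h.symm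

variable {κ x}

theorem lintegral_chainLaw_zero {g : E → ℝ≥0∞} (hg : Measurable g) :
    ∫⁻ c, g (c 0) ∂chainLaw κ x = g x := by
  rw [← lintegral_map hg (measurable_pi_apply 0), chainLaw_map_zero, lintegral_dirac' _ hg]

theorem lintegral_chainLaw_succ {g : E → ℝ≥0∞} (hg : Measurable g) (n : ℕ) :
    ∫⁻ c, g (c (n + 1)) ∂chainLaw κ x = ∫⁻ c, ∫⁻ z, g z ∂κ (c n) ∂chainLaw κ x := by
  rw [← lintegral_map (f := fun y => ∫⁻ z, g z ∂κ y) (by fun_prop) (measurable_pi_apply n),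
    ← Measure.lintegral_compProd (f := fun w => g w.2) (by fun_prop), ← chainLaw_map_succ,
    lintegral_map (by fun_prop) (by fun_prop)]

theorem ae_chainLaw_succ {p : E → E → Prop} (hp : MeasurableSet {w : E × E | p w.1 w.2})
    (h : ∀ y, ∀ᵐ z ∂κ y, p y z) : ∀ᵐ c ∂chainLaw κ x, ∀ n, p (c n) (c (n + 1)) := by
  refine ae_all_iff.2 fun n => ?_
  have hpair : ∀ᵐ w ∂(chainLaw κ x).map (fun c => (c n, c (n + 1))), p w.1 w.2 := by
    rw [chainLaw_map_succ, Measure.ae_compProd_iff hp]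
    exact ae_of_all _ h
  exact ae_of_ae_map (by fun_prop) hpair

/-- By the Poisson equation `f (c n) - n m` is a martingale, so the variances of its increments
add up. -/
theorem lintegral_sq_le_of_poisson {f : E → ℝ} (hf : Measurable f) {m B : ℝ}
    (hpoisson : ∀ y, ∫ z, f z ∂κ y = f y + m) (hB : ∀ y, ∀ᵐ z ∂κ y, |f z - f y| ≤ B) (n : ℕ) :
    ∫⁻ c, ENNReal.ofReal ((f (c n) - (f x + n * m)) ^ 2) ∂chainLaw κ x
      ≤ ENNReal.ofReal (n * B ^ 2) := by
  induction n with
  | zero =>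
    simp [lintegral_chainLaw_zero (g := fun y => ENNReal.ofReal ((f y - f x) ^ 2)) (by fun_prop)]
  | succ n ih =>
    have hstep : ∀ y, ∫⁻ z, ENNReal.ofReal ((f z - (f x + (n + 1) * m)) ^ 2) ∂κ y
        ≤ ENNReal.ofReal ((f y - (f x + n * m)) ^ 2) + ENNReal.ofReal (B ^ 2) := fun y => by
      have h := lintegral_sub_sq_le_of_abs_sub_le hf (hB y) (f x + (n + 1) * m)
      rwa [hpoisson, show f y + m - (f x + (n + 1) * m) = f y - (f x + n * m) by ring] at h
    calc ∫⁻ c, ENNReal.ofReal ((f (c (n + 1)) - (f x + (n + 1 : ℕ) * m)) ^ 2) ∂chainLaw κ x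
        = ∫⁻ c, ∫⁻ z, ENNReal.ofReal ((f z - (f x + (n + 1) * m)) ^ 2) ∂κ (c n) ∂chainLaw κ x := by
          push_cast
          exact lintegral_chainLaw_succ
            (g := fun z => ENNReal.ofReal ((f z - (f x + (n + 1) * m)) ^ 2)) (by fun_prop) n
      _ ≤ ∫⁻ c, (ENNReal.ofReal ((f (c n) - (f x + n * m)) ^ 2) + ENNReal.ofReal (B ^ 2))
            ∂chainLaw κ x := lintegral_mono fun c => hstep (c n)
      _ = ∫⁻ c, ENNReal.ofReal ((f (c n) - (f x + n * m)) ^ 2) ∂chainLaw κ x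
            + ENNReal.ofReal (B ^ 2) := by
          rw [lintegral_add_right _ measurable_const, lintegral_const, measure_univ, mul_one]
      _ ≤ ENNReal.ofReal (n * B ^ 2) + ENNReal.ofReal (B ^ 2) := by gcongr
      _ = ENNReal.ofReal ((n + 1 : ℕ) * B ^ 2) := by
          rw [← ENNReal.ofReal_add (by positivity) (by positivity)]
          push_cast; ring_nf

theorem ae_tendsto_div_of_poisson {f : E → ℝ} (hf : Measurable f) {m B : ℝ}
    (hpoisson : ∀ y, ∫ z, f z ∂κ y = f y + m) (hB : ∀ y, ∀ᵐ z ∂κ y, |f z - f y| ≤ B) :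
    ∀ᵐ c ∂chainLaw κ x, Tendsto (fun n : ℕ => f (c n) / n) atTop (𝓝 m) := by
  have hincr : ∀ᵐ c ∂chainLaw κ x, ∀ n, |f (c (n + 1)) - f (c n)| ≤ B :=
    ae_chainLaw_succ (p := fun y z => |f z - f y| ≤ B)
      (measurableSet_le (by fun_prop) measurable_const) hB
  have hmart : ∀ᵐ c ∂chainLaw κ x,
      Tendsto (fun n : ℕ => (f (c n) - (f x + n * m)) / n) atTop (𝓝 0) := by
    have hmeas : ∀ n : ℕ, Measurable fun c : ℕ → E => f (c n) - (f x + n * m) :=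
      fun n => (hf.comp (measurable_pi_apply n)).sub_const _
    have hlower : ∀ᵐ c ∂chainLaw κ x, ∀ n : ℕ,
        f (c n) - (f x + n * m) ≤ f (c (n + 1)) - (f x + (n + 1 : ℕ) * m) + (B + m) := by
      filter_upwards [hincr] with c hc n
      push_cast
      linarith [(abs_le.1 (hc n)).1]
    exact ae_tendsto_div_zero_of_lintegral_sq_le hmeas
      (lintegral_sq_le_of_poisson hf hpoisson hB) hlower
  filter_upwards [hmart] with c hc
  have hconst : Tendsto (fun n : ℕ => m + f x / n) atTop (𝓝 m) := by
    simpa using (tendsto_const_div_atTop_nhds_zero_nat (f x)).const_add m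
  refine (zero_add m ▸ hc.add hconst).congr' ?_
  filter_upwards [eventually_ne_atTop 0] with n hn
  field_simp
  ring

end MarkovChain

section CoinWalk

theorem integral_coinStep (p : I) (y : ℤ) (g : ℤ → ℝ) :
    ∫ z, g z ∂coinStep p y = p * g (y + 1) + (1 - p) * g (y - 1) := by
  rw [coinStep, integral_add_measure, integral_smul_measure, integral_smul_measure,
    integral_dirac, integral_dirac, ENNReal.toReal_ofReal p.2.1,
    ENNReal.toReal_ofReal (sub_nonneg.2 p.2.2), smul_eq_mul, smul_eq_mul]
  all_goals exact (integrable_dirac (by simp)).smul_measure ENNReal.ofReal_ne_top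

theorem ae_coinStep (p : I) (y : ℤ) : ∀ᵐ z ∂coinStep p y, |z - y| = 1 := by
  rw [coinStep, ae_add_measure_iff]
  constructor <;> refine Measure.ae_smul_measure ?_ _ <;> rw [ae_dirac_eq] <;> simp

/-- The coin that is effectively tossed when game `A`, respectively a `p`-coin, is played with
probability `γ`, respectively `1 - γ`. -/
def mixedCoin (γ p : I) : I :=
  ⟨γ * pA + (1 - γ) * p,
    convex_Icc 0 1 pA.2 p.2 γ.2.1 (sub_nonneg.2 γ.2.2) (add_sub_cancel _ _)⟩

theorem mixedCoin_p1_pos (ρ : ℝ≥0) (γ : I) : 0 < (mixedCoin γ (p1 ρ) : ℝ) := by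
  have hp1 : 0 < (p1 ρ : ℝ) := by simp only [p1]; positivity
  have hγ : 0 ≤ 1 - (γ : ℝ) := sub_nonneg.2 γ.2.2
  rcases γ.2.1.eq_or_lt with h | h
  · simpa [mixedCoin, ← h] using hp1
  · exact add_pos_of_pos_of_nonneg (mul_pos h (by norm_num [pA])) (mul_nonneg hγ hp1.le)

theorem smul_coinStep_add_smul_coinStep (γ p : I) (y : ℤ) :
    ENNReal.ofReal γ • coinStep pA y + ENNReal.ofReal (1 - γ) • coinStep p y
      = coinStep (mixedCoin γ p) y := by
  have hγ : 0 ≤ 1 - (γ : ℝ) := sub_nonneg.2 γ.2.2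
  have hA : 0 ≤ 1 - (pA : ℝ) := sub_nonneg.2 pA.2.2
  have hp : 0 ≤ 1 - (p : ℝ) := sub_nonneg.2 p.2.2
  have hlose : 1 - (mixedCoin γ p : ℝ) = γ * (1 - pA) + (1 - γ) * (1 - p) := by
    simp only [mixedCoin]; ring
  rw [coinStep, coinStep, coinStep, hlose, mixedCoin,
    ENNReal.ofReal_add (mul_nonneg γ.2.1 pA.2.1) (mul_nonneg hγ p.2.1),
    ENNReal.ofReal_add (mul_nonneg γ.2.1 hA) (mul_nonneg hγ hp), ENNReal.ofReal_mul γ.2.1,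
    ENNReal.ofReal_mul γ.2.1, ENNReal.ofReal_mul hγ, ENNReal.ofReal_mul hγ]
  module

theorem mixture_apply (r : ℕ) (ρ : ℝ≥0) (γ : I) (y : ℤ) :
    mixture r ρ γ y = coinStep (mixedCoin γ (if (r : ℤ) ∣ y then p0 r ρ else p1 ρ)) y :=
  smul_coinStep_add_smul_coinStep γ _ y

theorem capitalLaw_eq_chainLaw (r : ℕ) (ρ : ℝ≥0) (γ : I) (x : ℤ) :
    capitalLaw r ρ γ x = chainLaw (mixture r ρ γ) x := rfl

theorem isRateOfProfit_of_corrector {r : ℕ} {ρ : ℝ≥0} {γ : I} {h : ℤ → ℝ} {m C : ℝ} (x : ℤ)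
    (hC : ∀ y, |h y| ≤ C)
    (hpoisson : ∀ y, ∫ z, (z + h z) ∂mixture r ρ γ y = y + h y + m) :
    IsRateOfProfit r ρ γ x m := by
  have hincr : ∀ y, ∀ᵐ z ∂mixture r ρ γ y, |(z + h z) - (y + h y)| ≤ 1 + (C + C) := fun y => by
    rw [mixture_apply]
    filter_upwards [ae_coinStep _ y] with z hz
    have hz' : |(z : ℝ) - y| = 1 := by exact_mod_cast hz
    calc |(z + h z) - (y + h y)| = |(z - y : ℝ) + (h z - h y)| := by ring_nf
      _ ≤ |(z : ℝ) - y| + (|h z| + |h y|) := (abs_add_le _ _).trans (by gcongr; exact abs_sub _ _)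
      _ ≤ 1 + (C + C) := by rw [hz']; gcongr <;> exact hC _
  rw [IsRateOfProfit, capitalLaw_eq_chainLaw]
  filter_upwards [ae_tendsto_div_of_poisson (measurable_of_countable _) hpoisson hincr] with c hc
  have hcorr : Tendsto (fun n : ℕ => (h (c n) + c 0) / n) atTop (𝓝 0) := by
    refine squeeze_zero_norm (fun n => ?_) (tendsto_const_div_atTop_nhds_zero_nat (C + |(c 0 : ℝ)|))
    rw [Real.norm_eq_abs, abs_div, Nat.abs_cast]
    gcongr
    exact (abs_add_le _ _).trans (by gcongr; exact hC _)
  refine (sub_zero m ▸ hc.sub hcorr).congr fun n => ?_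
  push_cast
  ring

end CoinWalk

section Corrector

/-- The `r`-periodic function on `ℤ` which is `1 - s ^ k` minus its chord for `0 ≤ k ≤ r`. Apart
from the chord it is harmonic, off the multiples of `r`, for a walk whose odds of losing are `s`. -/
def cycleCorrector (r : ℕ) (s : ℝ) (y : ℤ) : ℝ :=
  1 - s ^ (y % r).toNat - (y % r).toNat / r * (1 - s ^ r)

theorem exists_eq_mul_add_natCast {r : ℕ} (hr : r ≠ 0) (y : ℤ) :
    ∃ (t : ℤ) (k : ℕ), k < r ∧ y = r * t + k := by
  have hpos : (0 : ℤ) < r := by positivity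
  have hlt := Int.emod_lt_of_pos y hpos
  have hnonneg := Int.emod_nonneg y hpos.ne'
  exact ⟨y / r, (y % r).toNat, by omega,
    by rw [Int.toNat_of_nonneg hnonneg, Int.mul_ediv_add_emod]⟩

theorem cycleCorrector_mul_add {r : ℕ} (hr : r ≠ 0) (s : ℝ) (t : ℤ) {k : ℕ} (hk : k ≤ r) :
    cycleCorrector r s (r * t + k) = 1 - s ^ k - k / r * (1 - s ^ r) := by
  rcases hk.lt_or_eq with hlt | rfl
  · have hmod : ((r : ℤ) * t + k) % r = k := by
      rw [Int.mul_add_emod_self_left, Int.emod_eq_of_lt (by omega) (by omega)]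
    rw [cycleCorrector, hmod, Int.toNat_natCast]
  · have hmod : ((k : ℤ) * t + k) % k = 0 := by simp
    rw [cycleCorrector, hmod]
    simp [hr]

theorem exists_abs_cycleCorrector_le {r : ℕ} (hr : r ≠ 0) (s : ℝ) :
    ∃ C, ∀ y, |cycleCorrector r s y| ≤ C := by
  refine ⟨∑ k ∈ Finset.range r, |1 - s ^ k - k / r * (1 - s ^ r)|, fun y => ?_⟩
  obtain ⟨t, k, hk, rfl⟩ := exists_eq_mul_add_natCast hr y
  rw [cycleCorrector_mul_add hr s t hk.le]
  exact Finset.single_le_sum (f := fun k : ℕ => |1 - s ^ k - k / r * (1 - s ^ r)|)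
    (fun _ _ => abs_nonneg _) (Finset.mem_range.2 hk)

theorem cycleCorrector_step_of_not_dvd {r : ℕ} (hr : r ≠ 0) {p s : ℝ} (hps : p * s = 1 - p)
    {y : ℤ} (hy : ¬(r : ℤ) ∣ y) :
    p * cycleCorrector r s (y + 1) + (1 - p) * cycleCorrector r s (y - 1)
      = cycleCorrector r s y - (2 * p - 1) * ((1 - s ^ r) / r) := by
  obtain ⟨t, k, hk, rfl⟩ := exists_eq_mul_add_natCast hr y
  obtain ⟨j, rfl⟩ := Nat.exists_eq_add_one_of_ne_zero (n := k) (by rintro rfl; simp at hy)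
  have hsucc := cycleCorrector_mul_add hr s t (k := j + 2) hk
  have hpred := cycleCorrector_mul_add hr s t (k := j) (by omega)
  rw [show (r : ℤ) * t + (j + 1 : ℕ) + 1 = r * t + (j + 2 : ℕ) by push_cast; ring,
    show (r : ℤ) * t + (j + 1 : ℕ) - 1 = r * t + j by push_cast; ring,
    hsucc, hpred, cycleCorrector_mul_add hr s t hk.le]
  push_cast
  linear_combination s ^ j * (1 - s) * hps

/-- The drift, at a multiple of `r` where the winning probability is `p₀`, of the function on `ℤ`
whose increments over each period are those of `k ↦ 1 - s ^ k` over `[0, r]`. -/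
def cycleDrift (r : ℕ) (s p₀ : ℝ) : ℝ :=
  (1 - s) * (p₀ - (1 - p₀) * s ^ (r - 1))

theorem cycleCorrector_step_of_dvd {r : ℕ} (hr : r ≠ 0) (s p₀ : ℝ) {y : ℤ} (hy : (r : ℤ) ∣ y) :
    p₀ * cycleCorrector r s (y + 1) + (1 - p₀) * cycleCorrector r s (y - 1)
      = cycleCorrector r s y + cycleDrift r s p₀ - (2 * p₀ - 1) * ((1 - s ^ r) / r) := by
  obtain ⟨t, rfl⟩ := hy
  obtain ⟨j, rfl⟩ := Nat.exists_eq_add_one_of_ne_zero hr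
  have hzero := cycleCorrector_mul_add hr s t (k := 0) (by omega)
  have hsucc := cycleCorrector_mul_add hr s t (k := 1) (by omega)
  have hpred := cycleCorrector_mul_add hr s (t - 1) (k := j) (by omega)
  rw [show ((j + 1 : ℕ) : ℤ) * (t - 1) + j = (j + 1 : ℕ) * t - 1 by push_cast; ring] at hpred
  rw [Nat.cast_zero, add_zero] at hzero
  rw [Nat.cast_one] at hsucc
  rw [hzero, hsucc, hpred, cycleDrift, Nat.add_sub_cancel]
  push_cast
  field_simp
  ring

/-- The amount by which the drift of the chord of `k ↦ 1 - s ^ k` over `[0, r]` is larger where the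
winning probability is `p` than where it is `p₀`. -/
def chordDrift (r : ℕ) (s p₀ p : ℝ) : ℝ :=
  2 * (p - p₀) * ((1 - s ^ r) / r)

/-- The odds of losing a toss of a `p`-coin. -/
def losingOdds (p : ℝ) : ℝ := (1 - p) / p

/-- The rate of profit of the nearest-neighbour walk on `ℤ` that wins one unit with probability
`p₀` at the multiples of `r` and with probability `p` elsewhere. -/
def periodicRate (r : ℕ) (p₀ p : ℝ) : ℝ :=
  (2 * p - 1) * cycleDrift r (losingOdds p) p₀
    / (cycleDrift r (losingOdds p) p₀ + chordDrift r (losingOdds p) p₀ p)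

theorem exists_corrector {r : ℕ} (hr : r ≠ 0) {p₀ p : ℝ} (hp : p ≠ 0)
    (hne : cycleDrift r (losingOdds p) p₀ + chordDrift r (losingOdds p) p₀ p ≠ 0)
    {w : ℤ → ℝ} (hw : ∀ y, w y = if (r : ℤ) ∣ y then p₀ else p) :
    ∃ h : ℤ → ℝ, (∃ C, ∀ y, |h y| ≤ C) ∧ ∀ y,
      w y * (1 + h (y + 1)) + (1 - w y) * (h (y - 1) - 1) = h y + periodicRate r p₀ p := by
  have hps : p * losingOdds p = 1 - p := mul_div_cancel₀ _ hp
  obtain ⟨C, hC⟩ := exists_abs_cycleCorrector_le hr (losingOdds p)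
  obtain ⟨β, hβ⟩ : ∃ β, β * (cycleDrift r (losingOdds p) p₀ + chordDrift r (losingOdds p) p₀ p)
      = 2 * (p - p₀) := ⟨_, div_mul_cancel₀ _ hne⟩
  have hrate : periodicRate r p₀ p = (2 * p - 1) * (1 - β * ((1 - losingOdds p ^ r) / r)) := by
    rw [periodicRate, div_eq_iff hne]
    simp only [chordDrift] at hβ ⊢
    linear_combination (2 * p - 1) * ((1 - losingOdds p ^ r) / r) * hβ
  refine ⟨fun y => β * cycleCorrector r (losingOdds p) y, ⟨|β| * C, fun y => ?_⟩, ?_⟩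
  · rw [abs_mul]
    gcongr
    exact hC y
  · intro y
    rw [hw, hrate]
    split_ifs with hy
    · have hstep := cycleCorrector_step_of_dvd hr (losingOdds p) p₀ hy
      simp only [chordDrift] at hβ
      linear_combination β * hstep + hβ
    · have hstep := cycleCorrector_step_of_not_dvd hr hps hy
      linear_combination β * hstep

end Corrector

theorem isRateOfProfit_periodicRate {r : ℕ} (hr : r ≠ 0) {ρ : ℝ≥0} {γ : I} {p₀ p : ℝ}
    (hp₀ : mixedCoin γ (p0 r ρ) = p₀) (hp : mixedCoin γ (p1 ρ) = p)
    (hne : cycleDrift r (losingOdds p) p₀ + chordDrift r (losingOdds p) p₀ p ≠ 0) (x : ℤ) :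
    IsRateOfProfit r ρ γ x (periodicRate r p₀ p) := by
  subst hp₀ hp
  obtain ⟨h, ⟨C, hC⟩, hstep⟩ := exists_corrector hr (mixedCoin_p1_pos ρ γ).ne' hne
    fun y => apply_ite (fun p => (mixedCoin γ p : ℝ)) ((r : ℤ) ∣ y) (p0 r ρ) (p1 ρ)
  refine isRateOfProfit_of_corrector x hC fun y => ?_
  rw [mixture_apply, integral_coinStep]
  push_cast
  linear_combination hstep y

section RhoZero

theorem mixedCoin_p0_rho_zero {r : ℕ} (hr : 2 ≤ r) (γ : I) :
    (mixedCoin γ (p0 r 0) : ℝ) = γ / 2 := by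
  have hexp : r - 1 ≠ 0 := by omega
  simp [mixedCoin, pA, p0, hexp, div_eq_mul_inv]

theorem mixedCoin_p1_rho_zero (γ : I) : (mixedCoin γ (p1 0) : ℝ) = 1 - γ / 2 := by
  simp only [mixedCoin, pA, p1, NNReal.coe_zero, add_zero, div_one]
  ring

theorem cycleDrift_losingOdds_one_sub {r : ℕ} (hr : 2 ≤ r) {q : ℝ} (hq : q ≠ 1) :
    cycleDrift r (losingOdds (1 - q)) q
      = (1 - losingOdds (1 - q)) * (1 - losingOdds (1 - q) ^ (r - 2)) * q := by
  obtain ⟨j, rfl⟩ := Nat.exists_eq_add_of_le' hr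
  have hs : (1 - q) * losingOdds (1 - q) = q := by
    rw [losingOdds, mul_div_cancel₀ _ (sub_ne_zero.2 hq.symm), sub_sub_cancel]
  rw [cycleDrift, Nat.add_sub_cancel, show j + 2 - 1 = j + 1 from rfl, pow_succ]
  linear_combination -(1 - losingOdds (1 - q)) * losingOdds (1 - q) ^ j * hs

theorem losingOdds_one_sub_mem_Ico {q : ℝ} (hq : q ∈ Set.Ico 0 (1 / 2)) :
    losingOdds (1 - q) ∈ Set.Ico (0 : ℝ) 1 := by
  have hpos : 0 < 1 - q := by linarith [hq.2]
  rw [losingOdds, sub_sub_cancel]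
  exact ⟨div_nonneg hq.1 hpos.le, (div_lt_one hpos).2 (by linarith [hq.2])⟩

theorem cycleDrift_add_chordDrift_pos {r : ℕ} (hr : 2 ≤ r) {q : ℝ} (hq : q ∈ Set.Ico 0 (1 / 2)) :
    0 < cycleDrift r (losingOdds (1 - q)) q + chordDrift r (losingOdds (1 - q)) q (1 - q) := by
  obtain ⟨hs0, hs1⟩ := losingOdds_one_sub_mem_Ico hq
  have hchord : 0 < 1 - losingOdds (1 - q) ^ r := sub_pos.2 (pow_lt_one₀ hs0 hs1 (by omega))
  have hdrift : 0 ≤ 1 - losingOdds (1 - q) ^ (r - 2) := sub_nonneg.2 (pow_le_one₀ hs0 hs1.le)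
  have hr' : (0 : ℝ) < r := by positivity
  rw [cycleDrift_losingOdds_one_sub hr (by linarith [hq.2])]
  exact add_pos_of_nonneg_of_pos (mul_nonneg (mul_nonneg (sub_nonneg.2 hs1.le) hdrift) hq.1)
    (mul_pos (by linarith [hq.2]) (div_pos hchord hr'))

theorem isRateOfProfit_rho_zero {r : ℕ} (hr : 2 ≤ r) {γ : I} (hγ : (γ : ℝ) < 1) (x : ℤ) :
    IsRateOfProfit r 0 γ x (periodicRate r (γ / 2) (1 - γ / 2)) := by
  have hq : (γ / 2 : ℝ) ∈ Set.Ico 0 (1 / 2) := ⟨by linarith [γ.2.1], by linarith⟩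
  exact isRateOfProfit_periodicRate (by omega) (mixedCoin_p0_rho_zero hr γ)
    (mixedCoin_p1_rho_zero γ) (cycleDrift_add_chordDrift_pos hr hq).ne' x

theorem gammaSeq_lt_one {r : ℕ} (hr : 5 ≤ r) : (gammaSeq r hr : ℝ) < 1 := by
  have hr5 : (5 : ℝ) ≤ r := by exact_mod_cast hr
  have htwo : 2 < √(r : ℝ) := Real.lt_sqrt_of_sq_lt (by linarith)
  exact (div_lt_one (by linarith)).2 htwo

end RhoZero

section Asymptotics

theorem tendsto_pow_zero_of_tendsto_zero {ι : Type*} {l : Filter ι} {a : ι → ℝ} {e : ι → ℕ}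
    (ha : Tendsto a l (𝓝 0)) (he : ∀ᶠ i in l, e i ≠ 0) :
    Tendsto (fun i => a i ^ e i) l (𝓝 0) := by
  have habs := (tendsto_zero_iff_abs_tendsto_zero a).1 ha
  refine squeeze_zero_norm' ?_ habs
  filter_upwards [he, habs.eventually_lt_const one_pos] with i hi hlt
  rw [norm_pow, Real.norm_eq_abs]
  exact pow_le_of_le_one (abs_nonneg _) hlt.le hi

variable {q : ℕ → ℝ}

theorem tendsto_losingOdds_one_sub (hq : Tendsto q atTop (𝓝 0)) :
    Tendsto (fun r => losingOdds (1 - q r)) atTop (𝓝 0) := by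
  simpa [losingOdds, Pi.div_def] using hq.div (hq.const_sub 1) (by norm_num)

theorem isEquivalent_cycleDrift (hq : Tendsto q atTop (𝓝 0)) :
    (fun r => cycleDrift r (losingOdds (1 - q r)) (q r)) ~[atTop] q := by
  have hs := tendsto_losingOdds_one_sub hq
  have hpow := tendsto_pow_zero_of_tendsto_zero (e := fun r => r - 2) hs
    ((eventually_ge_atTop 3).mono fun r hr => by omega)
  have hfactor : Tendsto
      (fun r => (1 - losingOdds (1 - q r)) * (1 - losingOdds (1 - q r) ^ (r - 2)))
      atTop (𝓝 1) := by
    simpa using (hs.const_sub 1).mul (hpow.const_sub 1)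
  refine isEquivalent_iff_exists_eq_mul.2 ⟨_, hfactor, ?_⟩
  filter_upwards [eventually_ge_atTop 2, hq.eventually_ne zero_ne_one] with r hr hne
  exact cycleDrift_losingOdds_one_sub hr hne

theorem isEquivalent_chordDrift (hq : Tendsto q atTop (𝓝 0)) :
    (fun r => chordDrift r (losingOdds (1 - q r)) (q r) (1 - q r)) ~[atTop] fun r => 2 / r := by
  have hpow := tendsto_pow_zero_of_tendsto_zero (e := id) (tendsto_losingOdds_one_sub hq)
    (eventually_ne_atTop 0)
  have hfactor : Tendsto (fun r => (1 - q r - q r) * (1 - losingOdds (1 - q r) ^ r))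
      atTop (𝓝 1) := by
    simpa using ((hq.const_sub 1).sub hq).mul (hpow.const_sub 1)
  refine isEquivalent_iff_exists_eq_mul.2 ⟨_, hfactor, Eventually.of_forall fun r => ?_⟩
  simp only [chordDrift, Pi.mul_apply]
  ring

theorem one_sub_periodicRate {r : ℕ} {p₀ p : ℝ}
    (hne : cycleDrift r (losingOdds p) p₀ + chordDrift r (losingOdds p) p₀ p ≠ 0) :
    1 - periodicRate r p₀ p
      = (2 * (1 - p) * cycleDrift r (losingOdds p) p₀ + chordDrift r (losingOdds p) p₀ p)
        / (cycleDrift r (losingOdds p) p₀ + chordDrift r (losingOdds p) p₀ p) := by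
  rw [periodicRate, eq_div_iff hne, sub_mul, div_mul_cancel₀ _ hne]
  ring

theorem isEquivalent_one_sub_periodicRate (hpos : ∀ᶠ r in atTop, 0 < q r)
    (hq : Tendsto q atTop (𝓝 0)) (hrq : Tendsto (fun r : ℕ => r * q r) atTop atTop) :
    (fun r => 1 - periodicRate r (q r) (1 - q r))
      ~[atTop] fun r : ℕ => 2 * q r + 2 / (r * q r) := by
  have hdrift := isEquivalent_cycleDrift hq
  have hchord := isEquivalent_chordDrift hq
  have hsmall : (fun r : ℕ => 2 / (r : ℝ)) =o[atTop] q := by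
    refine (isLittleO_iff_tendsto' (hpos.mono fun r hr h => absurd h hr.ne')).2 ?_
    simpa only [div_div] using tendsto_const_nhds.div_atTop hrq
  have hden := hdrift.add_isLittleO (hchord.isBigO.trans_isLittleO hsmall)
  have hsq : (fun r => 2 * q r * cycleDrift r (losingOdds (1 - q r)) (q r))
      ~[atTop] fun r => 2 * q r * q r := IsEquivalent.refl.mul hdrift
  have hnonneg : ∀ r, 0 ≤ 2 * q r * q r := fun r => by
    rw [mul_assoc]
    exact mul_nonneg zero_le_two (mul_self_nonneg _)
  have hnum := IsEquivalent.add_add_of_nonneg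
    hnonneg (fun r => div_nonneg zero_le_two r.cast_nonneg) hsq hchord
  refine ((hnum.div hden).congr_left ?_).congr_right ?_
  · filter_upwards [eventually_ge_atTop 2, hpos, hq.eventually_lt_const one_half_pos]
      with r hr hr0 hr1
    rw [one_sub_periodicRate (cycleDrift_add_chordDrift_pos hr ⟨hr0.le, hr1⟩).ne', sub_sub_cancel]
    rfl
  · filter_upwards [hpos] with r hr
    simp only [Pi.div_apply, Pi.add_apply]
    field_simp

end Asymptotics

end

end Parrondo

theorem corollary5 :
    ∃ μ : ℕ → ℝ,
      (∀ (r : ℕ) (hr : 5 ≤ r) (x : ℤ),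
        Parrondo.IsRateOfProfit r 0 (Parrondo.gammaSeq r hr) x (μ r)) ∧
      (fun r : ℕ => 1 - μ r) ~[atTop] (fun r : ℕ => 2 * (2 / √(r : ℝ))) := by
  have hsqrt : Tendsto (fun r : ℕ => √(r : ℝ)) atTop atTop :=
    Real.tendsto_sqrt_atTop.comp tendsto_natCast_atTop_atTop
  refine ⟨fun r => Parrondo.periodicRate r (1 / √r) (1 - 1 / √r), fun r hr x => ?_, ?_⟩
  · have hhalf : (Parrondo.gammaSeq r hr : ℝ) / 2 = 1 / √r := by
      simp only [Parrondo.gammaSeq]; ring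
    simpa only [hhalf] using
      Parrondo.isRateOfProfit_rho_zero (by omega) (Parrondo.gammaSeq_lt_one hr) x
  · have hpos : ∀ᶠ r : ℕ in atTop, 0 < 1 / √(r : ℝ) :=
      (hsqrt.eventually_gt_atTop 0).mono fun r => one_div_pos.2
    have hmul : ∀ r : ℕ, r * (1 / √(r : ℝ)) = √r := fun r => by
      rw [mul_one_div, Real.div_sqrt]
    refine (Parrondo.isEquivalent_one_sub_periodicRate hpos
      (tendsto_const_nhds.div_atTop hsqrt) (by simpa only [hmul] using hsqrt)).trans_eventuallyEq
      (Eventually.of_forall fun r => ?_)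
    simp only [hmul]
    ring
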